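/- Let $\mathrm{Sch}$ denote the category of schemes of finite type over $\mathbb{Q}$, with morphisms of $\mathbb{Q}$-schemes. Let $\mathcal{A}$ be the full subcategory of the category of endofunctors of $\mathrm{Sch}$ (with natural transformations as morphisms) consisting of those functors $F:\mathrm{Sch}\to\mathrm{Sch}$ that preserve all finite limits and all finite colimits which exist in $\mathrm{Sch}$. Let $\mathcal{R}$ be the category of unital (associative, not necessarily commutative) ring objects in $\mathrm{Sch}$, with morphisms of unital ring objects. Let $\mathbb{G}_a=\mathbb{A}^1_{\mathbb{Q}}$ carry its standard ring structure, that is, the one for which $\operatorname{Hom}(X,\mathbb{G}_a)\cong\Gamma(X,\mathcal{O}_X)$ is an isomorphism of rings for every $X$. For $F\in\mathcal{A}$ the object $F(\mathbb{G}_a)$ is a unital ring object, because $F$ preserves finite products, and for a morphism $\phi:F\to G$ in $\mathcal{A}$ the component $\phi_{\mathbb{G}_a}:F(\mathbb{G}_a)\to G(\mathbb{G}_a)$ is a morphism of unital ring objects. Then the resulting evaluation functor $$\mathrm{Ev}:\mathcal{A}\to\mathcal{R},\qquad F\mapsto F(\mathbb{G}_a),\quad \phi\mapsto\phi_{\mathbb{G}_a},$$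 is fully faithful. -/

import Mathlib

open CategoryTheory Limits MonoidalCategory CartesianMonoidalCategory AlgebraicGeometry Opposite
open scoped MonObj AddMonObj

noncomputable section

namespace SchQ

/-! ### Ring objects: transport along functors, and representability -/

section RingObjects

universe v u

variable {C : Type u} [Category.{v} C] [CartesianMonoidalCategory C]

/-- The property of endofunctors of preserving all finite limits and all finite colimits
which exist in the category. -/
def preservesFinite (C : Type u) [Category.{v} C] : ObjectProperty (C ⥤ C) :=
  fun F => PreservesFiniteLimits F ∧ PreservesFiniteColimits F

/-- The category of endofunctors preserving finite limits and finite colimits; its morphisms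
are all natural transformations. -/
abbrev ExactEnd (C : Type u) [Category.{v} C] := (preservesFinite C).FullSubcategory

lemma exists_factor (F : C ⥤ C) [PreservesFiniteProducts F] {X R : C} (a b c : X ⟶ F.obj R) :
    ∃ (k : X ⟶ F.obj (R ⊗ (R ⊗ R))) (p q r : R ⊗ (R ⊗ R) ⟶ R),
      k ≫ F.map p = a ∧ k ≫ F.map q = b ∧ k ≫ F.map r = c := by
  let _ : F.Monoidal := Functor.Monoidal.ofChosenFiniteProducts F
  refine ⟨lift a (lift b c ≫ Functor.LaxMonoidal.μ F R R) ≫ Functor.LaxMonoidal.μ F R (R ⊗ R),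
    fst R (R ⊗ R), snd R (R ⊗ R) ≫ fst R R, snd R (R ⊗ R) ≫ snd R R, ?_, ?_, ?_⟩ <;> simp

variable [BraidedCategory C]

/-- The image of a ring object `R` under a functor preserving finite products. The operations are
the images under `F` of those of `R`, precomposed with the canonical isomorphisms
`F R ⊗ F R ≅ F (R ⊗ R)` and `𝟙_ C ≅ F (𝟙_ C)`. -/
@[reducible]
def ringObjObj (F : C ⥤ C) [PreservesFiniteProducts F] (R : C) [RingObj R] :
    RingObj (F.obj R) :=
  letI : F.Braided := Functor.Braided.ofChosenFiniteProducts F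
  letI : AddGrpObj (F.obj R) := F.addGrpObjObj
  letI : MonObj (F.obj R) := F.monObjObj R
  { toAddGrpObj := F.addGrpObjObj
    toMonObj := F.monObjObj R
    add_comm := by
      change (β_ (F.obj R) (F.obj R)).hom ≫ Functor.LaxMonoidal.μ F R R ≫ F.map σ =
        Functor.LaxMonoidal.μ F R R ≫ F.map σ
      rw [← Functor.LaxBraided.braided_assoc, ← F.map_comp, IsCommAddMonObj.add_comm]
    mul_add := by
      rw [mul_add_iff]
      intro X a b c
      obtain ⟨k, p, q, r, rfl, rfl, rfl⟩ := exists_factor F a b c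
      simp only [← MonObj.comp_mul, ← AddMonObj.comp_add, ← Functor.map_mul, ← Functor.map_add',
        Hom.mul_add]
    add_mul := by
      rw [add_mul_iff]
      intro X a b c
      obtain ⟨k, p, q, r, rfl, rfl, rfl⟩ := exists_factor F a b c
      simp only [← MonObj.comp_mul, ← AddMonObj.comp_add, ← Functor.map_mul, ← Functor.map_add',
        Hom.add_mul] }

/-- The evaluation functor at a ring object `R`, from endofunctors preserving finite limits and
colimits to ring objects. -/
def ev (R : RingObjCat C) : ExactEnd C ⥤ RingObjCat C where
  obj F :=
    haveI : PreservesFiniteLimits F.obj := F.property.1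
    { X := F.obj.obj R.X
      ringObj := ringObjObj F.obj R.X }
  map {F G} α :=
    haveI : PreservesFiniteLimits F.obj := F.property.1
    haveI : PreservesFiniteLimits G.obj := G.property.1
    letI := ringObjObj F.obj R.X
    letI := ringObjObj G.obj R.X
    { hom := α.hom.app R.X
      isRingHom :=
        letI : F.obj.Braided := Functor.Braided.ofChosenFiniteProducts F.obj
        letI : G.obj.Braided := Functor.Braided.ofChosenFiniteProducts G.obj
        { zero_hom := by
            change (Functor.LaxMonoidal.ε F.obj ≫ F.obj.map ζ) ≫ α.hom.app R.X =
              Functor.LaxMonoidal.ε G.obj ≫ G.obj.map ζ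
            rw [Category.assoc, α.hom.naturality, NatTrans.IsMonoidal.unit_assoc]
          add_hom := by
            change (Functor.LaxMonoidal.μ F.obj R.X R.X ≫ F.obj.map σ) ≫ α.hom.app R.X =
              (α.hom.app R.X ⊗ₘ α.hom.app R.X) ≫
                Functor.LaxMonoidal.μ G.obj R.X R.X ≫ G.obj.map σ
            rw [Category.assoc, α.hom.naturality, NatTrans.IsMonoidal.tensor_assoc]
          one_hom := by
            change (Functor.LaxMonoidal.ε F.obj ≫ F.obj.map η) ≫ α.hom.app R.X =
              Functor.LaxMonoidal.ε G.obj ≫ G.obj.map η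
            rw [Category.assoc, α.hom.naturality, NatTrans.IsMonoidal.unit_assoc]
          mul_hom := by
            change (Functor.LaxMonoidal.μ F.obj R.X R.X ≫ F.obj.map μ) ≫ α.hom.app R.X =
              (α.hom.app R.X ⊗ₘ α.hom.app R.X) ≫
                Functor.LaxMonoidal.μ G.obj R.X R.X ≫ G.obj.map μ
            rw [Category.assoc, α.hom.naturality, NatTrans.IsMonoidal.tensor_assoc] } }
  map_id F := rfl
  map_comp α β := rfl

/-- If `X` represents a presheaf of commutative rings, then `X` is a ring object, with the
operations which correspond to those of the presheaf. -/
@[reducible]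
def ringObjOfRepresentableBy (X : C) (P : Cᵒᵖ ⥤ CommRingCat.{v})
    (α : (P ⋙ CategoryTheory.forget _).RepresentableBy X) : RingObj X :=
  letI : AddGrpObj X := AddGrpObj.ofRepresentableBy X
    (P ⋙ forget₂ CommRingCat RingCat ⋙ forget₂ RingCat AddCommGrpCat ⋙
      forget₂ AddCommGrpCat AddGrpCat) α
  letI : MonObj X := MonObj.ofRepresentableBy X
    (P ⋙ forget₂ CommRingCat CommMonCat ⋙ forget₂ CommMonCat MonCat) α
  have hadd : ∀ {Y : C} (a b : Y ⟶ X), (α.homEquiv (a + b) : P.obj (op Y)) =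
      (α.homEquiv a : P.obj (op Y)) + (α.homEquiv b : P.obj (op Y)) := by
    intro Y a b
    exact ((yonedaAddGrpObjIsoOfRepresentableBy X (P ⋙ forget₂ CommRingCat RingCat ⋙
      forget₂ RingCat AddCommGrpCat ⋙ forget₂ AddCommGrpCat AddGrpCat) α).hom.app
        (op Y)).hom.map_add a b
  have hmul : ∀ {Y : C} (a b : Y ⟶ X), (α.homEquiv (a * b) : P.obj (op Y)) =
      (α.homEquiv a : P.obj (op Y)) * (α.homEquiv b : P.obj (op Y)) := by
    intro Y a b
    exact ((yonedaMonObjIsoOfRepresentableBy X (P ⋙ forget₂ CommRingCat CommMonCat ⋙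
      forget₂ CommMonCat MonCat) α).hom.app (op Y)).hom.map_mul a b
  { toAddGrpObj := ‹AddGrpObj X›
    toMonObj := ‹MonObj X›
    add_comm := by
      have h : (β_ X X).hom ≫ σ[X] = σ[X] := by
        have h₁ : σ[X] = fst X X + snd X X := by
          rw [Hom.add_def, lift_fst_snd, Category.id_comp]
        rw [h₁, AddMonObj.comp_add, braiding_hom_fst, braiding_hom_snd]
        apply α.homEquiv.injective
        rw [hadd, hadd, _root_.add_comm]
      exact h
    mul_add := by
      rw [mul_add_iff]
      intro Y a b c
      apply α.homEquiv.injective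
      rw [hmul, hadd, hadd, hmul, hmul, _root_.mul_add]
    add_mul := by
      rw [add_mul_iff]
      intro Y a b c
      apply α.homEquiv.injective
      rw [hmul, hadd, hadd, hmul, hmul, _root_.add_mul] }

end RingObjects

/-! ### Schemes of finite type over `ℚ` -/

/-- The base scheme `Spec ℚ`. -/
abbrev base : Scheme.{0} := Spec (CommRingCat.of ℚ)

/-- A `ℚ`-scheme is of finite type if its structure morphism is locally of finite type
and quasi-compact. -/
def isFiniteType : ObjectProperty (Over base) :=
  fun X => LocallyOfFiniteType X.hom ∧ QuasiCompact X.hom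

/-- The category of schemes of finite type over `ℚ`, with all morphisms of `ℚ`-schemes. -/
abbrev Sch := isFiniteType.FullSubcategory

instance : isFiniteType.IsClosedUnderIsomorphisms where
  of_iso := by
    rintro X Y e ⟨h₁, h₂⟩
    have hw : Y.hom = e.inv.left ≫ X.hom := (Over.w e.inv).symm
    have : IsIso e.inv.left := inferInstanceAs (IsIso ((Over.forget base).map e.inv))
    constructor
    · rw [hw]; infer_instance
    · rw [hw]; infer_instance

lemma isFiniteType_unit : isFiniteType (𝟙_ (Over base)) := by
  constructor
  · change LocallyOfFiniteType (𝟙 base); infer_instance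
  · change QuasiCompact (𝟙 base); infer_instance

lemma isFiniteType_tensor {X Y : Over base} (hX : isFiniteType X) (hY : isFiniteType Y) :
    isFiniteType (X ⊗ Y) := by
  obtain ⟨h₁, h₂⟩ := hX
  obtain ⟨h₃, h₄⟩ := hY
  constructor
  · change LocallyOfFiniteType (pullback.fst X.hom Y.hom ≫ X.hom); infer_instance
  · change QuasiCompact (pullback.fst X.hom Y.hom ≫ X.hom); infer_instance

instance : isFiniteType.IsClosedUnderLimitsOfShape (Discrete PEmpty.{1}) where
  limitsOfShape_le := by
    rintro X ⟨p⟩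
    exact isFiniteType.prop_of_iso
      (IsLimit.conePointUniqueUpToIso isTerminalTensorUnit
        (IsTerminal.ofUniqueHom (Y := X)
          (fun Z => p.isLimit.lift ⟨Z, ⟨fun j => j.as.elim, fun {j} => j.as.elim⟩⟩)
          (fun Z m => p.isLimit.hom_ext (fun j => j.as.elim)))) isFiniteType_unit

instance : isFiniteType.IsClosedUnderLimitsOfShape (Discrete WalkingPair) where
  limitsOfShape_le := by
    rintro X ⟨p⟩
    have e := IsLimit.conePointsIsoOfNatIso
      (tensorProductIsBinaryProduct (p.diag.obj ⟨.left⟩) (p.diag.obj ⟨.right⟩)) p.isLimit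
      (diagramIsoPair p.diag).symm
    exact isFiniteType.prop_of_iso e
      (isFiniteType_tensor (p.prop_diag_obj _) (p.prop_diag_obj _))


instance : BraidedCategory Sch := .ofCartesianMonoidalCategory

/-! ### The additive group `𝔾ₐ` with its standard ring structure -/

/-- The affine line over `ℚ`. -/
def Ga : Sch where
  obj := Over.mk (𝔸(PUnit.{1}; base) ↘ base)
  property := ⟨by dsimp; infer_instance, by dsimp; infer_instance⟩

/-- The coordinate function of the affine line. -/
def gaCoord : Γ(Ga.obj.left, ⊤) := AffineSpace.coord base PUnit.unit

/-- The presheaf of commutative rings `X ↦ Γ(X, 𝒪_X)` on schemes of finite type over `ℚ`. -/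
def globalSections : Schᵒᵖ ⥤ CommRingCat.{0} :=
  (isFiniteType.ι ⋙ Over.forget base).op ⋙ Scheme.Γ

/-- A morphism `f : X ⟶ 𝔾ₐ` over `ℚ` corresponds to the global function `f^* t` on `X`, where `t` is the
coordinate function of the affine line. -/
def gaRepresentableBy : (globalSections ⋙ CategoryTheory.forget _).RepresentableBy Ga where
  homEquiv {X} :=
    { toFun f := f.hom.left.appTop gaCoord
      invFun s := ObjectProperty.homMk
        (Over.homMk (AffineSpace.homOfVector X.obj.hom (fun _ => s)) (by
          exact AffineSpace.homOfVector_over _ _))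
      left_inv f := by
        ext1
        ext1
        apply AffineSpace.hom_ext
        · exact (AffineSpace.homOfVector_over _ _).trans (Over.w f.hom).symm
        · intro i
          exact AffineSpace.homOfVector_appTop_coord _ _ _
      right_inv s := AffineSpace.homOfVector_appTop_coord _ _ _ }
  homEquiv_comp f g := by
    change (f ≫ g).hom.left.appTop _ = f.hom.left.appTop (g.hom.left.appTop _)
    rw [ObjectProperty.FullSubcategory.comp_hom, Over.comp_left, Scheme.Hom.comp_appTop]
    rfl

/-- `𝔾ₐ` with its standard ring structure: addition and multiplication of morphisms `X ⟶ 𝔾ₐ` are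
those of the corresponding global functions on `X`. -/
def GaRing : RingObjCat Sch where
  X := Ga
  ringObj := ringObjOfRepresentableBy Ga globalSections gaRepresentableBy

/-- Evaluation at the ring object `𝔾ₐ`. -/
def Ev : ExactEnd Sch ⥤ RingObjCat Sch := ev GaRing

end SchQ

end

/-! An affine scheme `U` of finite type over `ℚ` is cut out of some `𝔾ₐⁿ` by finitely many
polynomials, so it is an equalizer of two maps `𝔾ₐⁿ ⇉ 𝔾ₐᵐ`. A functor `G` in the category preserves
this equalizer, hence maps `T ⟶ G U` are the ring homomorphisms from `𝒪(U)` to `Hom(T, G 𝔾ₐ)`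
(`IsAffineFor.existsUnique`). For `T = F U` and a morphism of ring objects `φ : F 𝔾ₐ ⟶ G 𝔾ₐ`, the
homomorphism `s ↦ F s ≫ φ` therefore gives a unique component `F U ⟶ G U`, and uniqueness makes it
natural.

A general `X` is a coequalizer of affine schemes (`exists_isColimit_cofork`). As `F` preserves it,
the affine components descend uniquely to `F X ⟶ G X`; refining covers shows the result to be
compatible with every map from an affine scheme (`exists_component`). -/

noncomputable section

namespace SchQ

open scoped RingObj

/-! ### Affine objects relative to a ring object. -/

section RingObjects

universe v u

variable {C : Type u} [Category.{v} C] [CartesianMonoidalCategory C] [BraidedCategory C]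

/-- Precomposition with a morphism is a ring homomorphism on the rings of morphisms to a
ring object. -/
def precompRingHom (R : RingObjCat C) {X Y : C} (f : X ⟶ Y) : (Y ⟶ R.X) →+* (X ⟶ R.X) where
  toFun g := f ≫ g
  map_one' := MonObj.comp_one _
  map_mul' _ _ := MonObj.comp_mul _ _ _
  map_zero' := AddMonObj.comp_zero _
  map_add' _ _ := AddMonObj.comp_add _ _ _

/-- Postcomposition with a morphism of ring objects is a ring homomorphism. -/
def postcompRingHom {R S : RingObjCat C} (φ : R ⟶ S) (X : C) : (X ⟶ R.X) →+* (X ⟶ S.X) where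
  toFun g := g ≫ φ.hom
  map_one' := MonObj.one_comp _
  map_mul' _ _ := MonObj.mul_comp _ _ _
  map_zero' := AddMonObj.zero_comp _
  map_add' _ _ := AddMonObj.add_comp _ _ _

/-- A functor preserving finite limits induces ring homomorphisms on rings of morphisms to a
ring object. -/
def mapRingHom (R : RingObjCat C) (F : ExactEnd C) (X : C) :
    (X ⟶ R.X) →+* (F.obj.obj X ⟶ ((ev R).obj F).X) :=
  haveI : PreservesFiniteLimits F.obj := F.property.1
  letI : F.obj.Braided := Functor.Braided.ofChosenFiniteProducts F.obj
  { toFun g := F.obj.map g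
    map_one' := Functor.map_one F.obj
    map_mul' := Functor.map_mul F.obj
    map_zero' := Functor.map_zero' F.obj
    map_add' := Functor.map_add' F.obj }

@[simp] lemma precompRingHom_apply (R : RingObjCat C) {X Y : C} (f : X ⟶ Y) (g : Y ⟶ R.X) :
    precompRingHom R f g = f ≫ g := rfl

@[simp] lemma postcompRingHom_apply {R S : RingObjCat C} (φ : R ⟶ S) (X : C) (g : X ⟶ R.X) :
    postcompRingHom φ X g = g ≫ φ.hom := rfl

@[simp] lemma mapRingHom_apply (R : RingObjCat C) (F : ExactEnd C) (X : C) (g : X ⟶ R.X) :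
    mapRingHom R F X g = F.obj.map g := rfl

/-- Polynomials with rational coefficients can be evaluated on morphisms to `R`. -/
def HasPolynomialEval (R : RingObjCat C) : Prop :=
  ∀ (X : C) (n : ℕ) (x : Fin n → (X ⟶ R.X)),
    ∃ e : MvPolynomial (Fin n) ℚ →+* (X ⟶ R.X), ∀ i, e (MvPolynomial.X i) = x i

/-- An object `U` is affine of finite type with respect to the ring object `R` if it represents
the ring homomorphisms out of the ring of morphisms `U ⟶ R`, and this ring is a quotient of a
polynomial ring over `ℚ` in finitely many variables. -/
structure IsAffineFor (R : RingObjCat C) (U : C) : Prop where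
  bijective (X : C) : Function.Bijective (precompRingHom R : (X ⟶ U) → _)
  finiteType : ∃ (n : ℕ) (q : MvPolynomial (Fin n) ℚ →+* (U ⟶ R.X)), Function.Surjective q

/-- Homomorphisms out of `ℚ` are unique even into a noncommutative ring, so no `ℚ`-linearity has to
be tracked. -/
lemma mvPolynomial_rat_ringHom_ext {I A : Type*} [Ring A] {f g : MvPolynomial I ℚ →+* A}
    (h : ∀ i, f (.X i) = g (.X i)) : f = g :=
  MvPolynomial.ringHom_ext
    (fun r => congr($(RingHom.ext_rat (f.comp MvPolynomial.C) (g.comp MvPolynomial.C)) r)) h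

variable [HasFiniteProducts C]

/-- An affine object is an equalizer of a pair of morphisms between powers of `R`. -/
lemma IsAffineFor.exists_isLimit_fork {R : RingObjCat C} {U : C}
    {n : ℕ} (hU : ∀ X : C, Function.Bijective (precompRingHom R : (X ⟶ U) → _))
    {q : MvPolynomial (Fin n) ℚ →+* (U ⟶ R.X)} (hq : Function.Surjective q)
    {e : MvPolynomial (Fin n) ℚ →+* ((∏ᶜ fun _ : Fin n => R.X) ⟶ R.X)}
    (he : ∀ i, e (.X i) = Pi.π (fun _ : Fin n => R.X) i) :
    ∃ (m : ℕ) (g : Fin m → MvPolynomial (Fin n) ℚ) (_ : ∀ j, q (g j) = 0)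
      (w : Pi.lift (fun i => q (.X i)) ≫ Pi.lift (fun j => e (g j)) =
        Pi.lift (fun i => q (.X i)) ≫ Pi.lift (fun _ => 0)),
      Nonempty (IsLimit (Fork.ofι (Pi.lift fun i => q (.X i)) w)) := by
  -- Hilbert's basis theorem: finitely many equations `g j` define `U`.
  obtain ⟨m, g, hg⟩ := Submodule.fg_iff_exists_fin_generating_family.mp
    (IsNoetherian.noetherian (RingHom.ker q))
  have hg0 (j : Fin m) : q (g j) = 0 := by
    rw [← RingHom.mem_ker, ← hg]
    exact Submodule.subset_span ⟨j, rfl⟩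
  have hcomp : (precompRingHom R (Pi.lift fun i => q (.X i))).comp e = q :=
    mvPolynomial_rat_ringHom_ext fun i => by simp [he]
  have w : Pi.lift (fun i => q (.X i)) ≫ Pi.lift (fun j => e (g j)) =
      Pi.lift (fun i => q (.X i)) ≫ Pi.lift (fun _ => 0) := by
    refine Pi.hom_ext _ _ fun j => ?_
    simp only [Category.assoc, Pi.lift_π]
    exact (congr($hcomp (g j)).trans (hg0 j)).trans (map_zero (precompRingHom R _)).symm
  -- Evaluation at `k` kills the generators of `ker q`, so it factors through `q`; representability
  -- turns the factor into a map to `U`.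
  have key {Z : C} (k : Z ⟶ ∏ᶜ fun _ : Fin n => R.X)
      (hk : k ≫ Pi.lift (fun j => e (g j)) = k ≫ Pi.lift (fun _ => 0)) :
      ∃ l : Z ⟶ U, l ≫ Pi.lift (fun i => q (.X i)) = k := by
    have hker : RingHom.ker q ≤ RingHom.ker ((precompRingHom R k).comp e) := by
      rw [← hg, Ideal.submodule_span_eq, Ideal.span_le]
      rintro _ ⟨j, rfl⟩
      have h := congr($hk ≫ Pi.π _ j)
      simp only [Category.assoc, Pi.lift_π] at h
      exact h.trans (map_zero (precompRingHom R k))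
    obtain ⟨l, hl⟩ := (hU Z).2 (q.liftOfSurjective hq ⟨_, hker⟩)
    refine ⟨l, Pi.hom_ext _ _ fun i => ?_⟩
    have h := congr($hl (q (.X i)))
    rw [RingHom.liftOfSurjective_comp_apply] at h
    simpa [he] using h
  have uniq {Z : C} (l l' : Z ⟶ U)
      (h : l ≫ Pi.lift (fun i => q (.X i)) = l' ≫ Pi.lift (fun i => q (.X i))) : l = l' := by
    apply (hU Z).1
    rw [← RingHom.cancel_right hq]
    refine mvPolynomial_rat_ringHom_ext fun i => ?_
    simpa using congr($h ≫ Pi.π _ i)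
  exact ⟨m, g, hg0, w, ⟨Fork.IsLimit.ofExistsUnique fun s =>
    ⟨(key s.ι s.condition).choose, (key s.ι s.condition).choose_spec,
      fun l hl => uniq _ _ (hl.trans (key s.ι s.condition).choose_spec.symm)⟩⟩⟩

/-- If `U` is affine with respect to `R`, then `G U` represents the ring homomorphisms from the
ring of morphisms `U ⟶ R` to rings of morphisms to the ring object `G R`. -/
lemma IsAffineFor.existsUnique {R : RingObjCat C} (hR : HasPolynomialEval R) {U : C}
    (hU : IsAffineFor R U) (G : ExactEnd C) {T : C}
    (ψ : (U ⟶ R.X) →+* (T ⟶ ((ev R).obj G).X)) :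
    ∃! u : T ⟶ G.obj.obj U, ∀ s : U ⟶ R.X, u ≫ G.obj.map s = ψ s := by
  have : PreservesFiniteLimits G.obj := G.property.1
  obtain ⟨n, q, hq⟩ := hU.finiteType
  obtain ⟨e, he⟩ := hR _ n (Pi.π fun _ : Fin n => R.X)
  obtain ⟨m, g, hg0, w, ⟨hlim⟩⟩ := exists_isLimit_fork hU.bijective hq he
  have hG := isLimitForkMapOfIsLimit G.obj w hlim
  have hprod (k : ℕ) : IsLimit (Fan.mk _ fun i => G.obj.map (Pi.π (fun _ : Fin k => R.X) i)) :=
    isLimitFanMkObjOfIsLimit G.obj _ _ (productIsProduct _)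
  -- Both sides are ring homomorphisms in `p`, so agreement on the variables suffices.
  have eval (v : T ⟶ G.obj.obj (∏ᶜ fun _ : Fin n => R.X))
      (hv : ∀ i, v ≫ G.obj.map (Pi.π _ i) = ψ (q (.X i))) (p : MvPolynomial (Fin n) ℚ) :
      v ≫ G.obj.map (e p) = ψ (q p) := by
    have : ((precompRingHom ((ev R).obj G) v).comp (mapRingHom R G _)).comp e = ψ.comp q :=
      mvPolynomial_rat_ringHom_ext fun i => by simpa [he] using! hv i
    exact congr($this p)
  obtain ⟨t, ht⟩ : ∃ t : T ⟶ G.obj.obj (∏ᶜ fun _ : Fin n => R.X),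
      ∀ i, t ≫ G.obj.map (Pi.π _ i) = ψ (q (.X i)) :=
    ⟨Fan.IsLimit.lift (hprod n) fun i => ψ (q (.X i)), fun i => Fan.IsLimit.fac (hprod n) _ i⟩
  have hfork : t ≫ G.obj.map (Pi.lift fun j => e (g j)) =
      t ≫ G.obj.map (Pi.lift fun _ => 0) := by
    refine Fan.IsLimit.hom_ext (hprod m) _ _ fun j => ?_
    change (t ≫ G.obj.map _) ≫ G.obj.map (Pi.π _ j) = (t ≫ G.obj.map _) ≫ G.obj.map (Pi.π _ j)
    simp only [Category.assoc, ← Functor.map_comp, Pi.lift_π]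
    rw [eval t ht, hg0, map_zero]
    exact (map_zero ((precompRingHom ((ev R).obj G) t).comp (mapRingHom R G _))).symm
  obtain ⟨u, hu⟩ := Fork.IsLimit.lift' hG t hfork
  refine ⟨u, fun s => ?_, fun u' hu' => ?_⟩
  · have : (precompRingHom ((ev R).obj G) u).comp (mapRingHom R G _) = ψ := by
      rw [← RingHom.cancel_right hq]
      refine mvPolynomial_rat_ringHom_ext fun i => ?_
      have h := ht i
      rw [← hu] at h
      simpa [← Functor.map_comp] using! h
    exact congr($this s)
  · refine Fork.IsLimit.hom_ext hG (Eq.trans ?_ hu.symm)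
    refine Fan.IsLimit.hom_ext (hprod n) _ _ fun i => ?_
    have h := (hu' (q (.X i))).trans (ht i).symm
    simpa [← Functor.map_comp] using! h

end RingObjects

/-! ### Affine schemes of finite type over `ℚ`. -/

instance (Y : Scheme.{0}) : Subsingleton (Y ⟶ base) :=
  ⟨fun _ _ => ext_to_Spec (CommRingCat.hom_ext (RingHom.ext_rat (R := Γ(Y, ⊤)) (F := ℚ →+* Γ(Y, ⊤)) _ _))⟩

/-- Any morphism of schemes between `ℚ`-schemes is a morphism of `ℚ`-schemes. -/
def homOfLeft {X Y : Sch} (f : X.obj.left ⟶ Y.obj.left) : X ⟶ Y :=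
  ObjectProperty.homMk (Over.homMk f (Subsingleton.elim _ _))

@[simp] lemma homOfLeft_left {X Y : Sch} (f : X.obj.left ⟶ Y.obj.left) :
    (homOfLeft f).hom.left = f := rfl

lemma hom_ext_left {X Y : Sch} {f g : X ⟶ Y} (h : f.hom.left = g.hom.left) : f = g := by
  ext1; ext1; exact h

/-- Morphisms to `𝔾ₐ` are global functions, as rings. -/
def gaRingEquiv (X : Sch) : (X ⟶ GaRing.X) ≃+* Γ(X.obj.left, ⊤) where
  toEquiv := gaRepresentableBy.homEquiv
  map_add' a b := ((yonedaAddGrpObjIsoOfRepresentableBy Ga (globalSections ⋙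
    forget₂ CommRingCat RingCat ⋙ forget₂ RingCat AddCommGrpCat ⋙
      forget₂ AddCommGrpCat AddGrpCat) gaRepresentableBy).hom.app (op X)).hom.map_add a b
  map_mul' a b := ((yonedaMonObjIsoOfRepresentableBy Ga (globalSections ⋙
    forget₂ CommRingCat CommMonCat ⋙ forget₂ CommMonCat MonCat)
      gaRepresentableBy).hom.app (op X)).hom.map_mul a b

lemma gaRingEquiv_comp {X Y : Sch} (f : X ⟶ Y) (s : Y ⟶ GaRing.X) :
    gaRingEquiv X (f ≫ s) = f.hom.left.appTop (gaRingEquiv Y s) :=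
  gaRepresentableBy.homEquiv_comp f s

/-- The structure of a `ℚ`-algebra on global functions. -/
def ratRingHom (X : Sch) : ℚ →+* Γ(X.obj.left, ⊤) :=
  X.obj.hom.appTop.hom.comp (Scheme.ΓSpecIso (CommRingCat.of ℚ)).inv.hom

lemma hasPolynomialEval_gaRing : HasPolynomialEval GaRing := fun X n x =>
  ⟨(gaRingEquiv X).symm.toRingHom.comp
    (MvPolynomial.eval₂Hom (ratRingHom X) fun i => gaRingEquiv X (x i)), fun i => by simp⟩

lemma isAffineFor_gaRing (U : Sch) [IsAffine U.obj.left] : IsAffineFor GaRing U where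
  bijective X := by
    refine ⟨fun f g h => hom_ext_left (ext_of_isAffine ?_), fun ψ => ?_⟩
    · ext s
      have := congr(gaRingEquiv X ($h ((gaRingEquiv U).symm s)))
      simpa [gaRingEquiv_comp] using this
    · let θ : Γ(U.obj.left, ⊤) ⟶ Γ(X.obj.left, ⊤) := CommRingCat.ofHom
        (((gaRingEquiv X).toRingHom.comp ψ).comp (gaRingEquiv U).symm.toRingHom)
      refine ⟨homOfLeft (X.obj.left.toSpecΓ ≫ Spec.map θ ≫ inv U.obj.left.toSpecΓ), ?_⟩
      refine RingHom.ext fun s => ?_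
      apply (gaRingEquiv X).injective
      -- Compose with `U ≅ Spec Γ(U)` and cancel the resulting isomorphism on global sections.
      have hθ : (X.obj.left.toSpecΓ ≫ Spec.map θ ≫ inv U.obj.left.toSpecΓ).appTop = θ := by
        have h := congr(Scheme.Hom.appTop $(show (X.obj.left.toSpecΓ ≫ Spec.map θ ≫
          inv U.obj.left.toSpecΓ) ≫ U.obj.left.toSpecΓ = X.obj.left.toSpecΓ ≫ Spec.map θ by simp))
        rw [Scheme.Hom.comp_appTop, Scheme.Hom.comp_appTop X.obj.left.toSpecΓ (Spec.map θ),
          Scheme.toSpecΓ_appTop, Scheme.toSpecΓ_appTop, Scheme.ΓSpecIso_naturality] at h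
        exact (cancel_epi _).mp h
      rw [precompRingHom_apply, gaRingEquiv_comp, homOfLeft_left, hθ]
      simp [θ]
  finiteType := by
    have := U.property.1
    have h : (ratRingHom U).FiniteType :=
      (HasRingHomProperty.appTop @LocallyOfFiniteType U.obj.hom this).comp
        (RingHom.FiniteType.of_surjective _
          (Scheme.ΓSpecIso (CommRingCat.of ℚ)).commRingCatIsoToRingEquiv.symm.surjective)
    let := (ratRingHom U).toAlgebra
    obtain ⟨n, f, hf⟩ := Algebra.FiniteType.iff_quotient_mvPolynomial''.mp h
    exact ⟨n, (gaRingEquiv U).symm.toRingHom.comp f.toRingHom,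
      (gaRingEquiv U).symm.surjective.comp hf⟩

instance : IsZariskiLocalAtSource (@LocallyOfFiniteType : MorphismProperty Scheme.{0}) :=
  HasRingHomProperty.instIsZariskiLocalAtSource

/-- An affine scheme which is locally of finite type over a scheme of finite type over `ℚ`,
as a scheme of finite type over `ℚ`. -/
def ofAffine (X : Sch) {Y : Scheme.{0}} [IsAffine Y] (f : Y ⟶ X.obj.left)
    [LocallyOfFiniteType f] : Sch where
  obj := Over.mk (f ≫ X.obj.hom)
  property := by
    have := X.property.1
    exact ⟨by dsimp; infer_instance, by dsimp; infer_instance⟩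

/-! ### Schemes as coequalizers of affine schemes. -/

section Covers

variable (X : Sch) (𝒰 : Scheme.OpenCover.{0} X.obj.left) [Finite 𝒰.I₀] [∀ i, IsAffine (𝒰.X i)]

instance : LocallyOfFiniteType (Sigma.desc 𝒰.f) :=
  IsZariskiLocalAtSource.sigmaDesc fun _ => inferInstance

/-- The disjoint union of the members of a finite affine open cover. -/
def coverSch : Sch := ofAffine X (Sigma.desc 𝒰.f)

instance : IsAffine (coverSch X 𝒰).obj.left :=
  inferInstanceAs (IsAffine (∐ 𝒰.X))

/-- The morphism from the disjoint union of the members of an open cover. -/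
def coverMap : coverSch X 𝒰 ⟶ X := homOfLeft (Sigma.desc 𝒰.f)

/-- Makes overlaps of affine opens quasi-compact, hence covered by finitely many affines. -/
instance quasiSeparatedSpace : QuasiSeparatedSpace X.obj.left :=
  have := X.property.1
  have : IsLocallyNoetherian X.obj.left := LocallyOfFiniteType.isLocallyNoetherian X.obj.hom
  inferInstance

instance compactSpace : CompactSpace X.obj.left :=
  have := X.property.2
  QuasiCompact.compactSpace_of_compactSpace X.obj.hom

/-- A finite affine open cover exhibits `X` as the coequalizer of a pair of morphisms of affine
schemes of finite type over `ℚ`. -/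
lemma exists_isColimit_cofork :
    ∃ (V : Sch) (_ : IsAffine V.obj.left) (a b : V ⟶ coverSch X 𝒰)
      (w : a ≫ coverMap X 𝒰 = b ≫ coverMap X 𝒰),
      Nonempty (IsColimit (Cofork.ofπ (coverMap X 𝒰) w)) := by
  -- `X` need not be separated, so overlaps need not be affine; each is covered by finitely many
  -- affines.
  let 𝒲 (k : 𝒰.I₀ × 𝒰.I₀) := (pullback (𝒰.f k.1) (𝒰.f k.2)).affineCover.finiteSubcover
  let Y (k : Σ k, (𝒲 k).I₀) : Scheme.{0} := (𝒲 k.1).X k.2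
  let f (k : Σ k, (𝒲 k).I₀) : Y k ⟶ X.obj.left :=
    (𝒲 k.1).f k.2 ≫ pullback.fst _ _ ≫ 𝒰.f k.1.1
  have : LocallyOfFiniteType (Sigma.desc f) :=
    IsZariskiLocalAtSource.sigmaDesc fun _ => by dsimp [f]; infer_instance
  have (k : Σ k, (𝒲 k).I₀) : IsAffine (Y k) := by dsimp [Y]; infer_instance
  let a : ∐ Y ⟶ ∐ 𝒰.X := Sigma.desc fun k =>
    (𝒲 k.1).f k.2 ≫ pullback.fst _ _ ≫ Sigma.ι 𝒰.X k.1.1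
  let b : ∐ Y ⟶ ∐ 𝒰.X := Sigma.desc fun k =>
    (𝒲 k.1).f k.2 ≫ pullback.snd _ _ ≫ Sigma.ι 𝒰.X k.1.2
  let V := ofAffine X (Sigma.desc f)
  let a' : V ⟶ coverSch X 𝒰 := homOfLeft a
  let b' : V ⟶ coverSch X 𝒰 := homOfLeft b
  have w : a' ≫ coverMap X 𝒰 = b' ≫ coverMap X 𝒰 := by
    apply hom_ext_left
    change a ≫ Sigma.desc 𝒰.f = b ≫ Sigma.desc 𝒰.f
    refine Sigma.hom_ext _ _ fun k => ?_
    simp [a, b, pullback.condition]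
  refine ⟨V, inferInstanceAs (IsAffine (∐ Y)), a', b', w,
    ⟨Cofork.IsColimit.ofExistsUnique fun s => ?_⟩⟩
  let π : ∐ 𝒰.X ⟶ s.pt.obj.left := s.π.hom.left
  have hπ : a ≫ π = b ≫ π := congr(($s.condition).hom.left)
  have hglue (i j : 𝒰.I₀) : pullback.fst (𝒰.f i) (𝒰.f j) ≫ Sigma.ι 𝒰.X i ≫ π =
      pullback.snd (𝒰.f i) (𝒰.f j) ≫ Sigma.ι 𝒰.X j ≫ π := by
    refine (𝒲 (i, j)).hom_ext _ _ fun k => ?_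
    have := congr(Sigma.ι Y ⟨(i, j), k⟩ ≫ $hπ)
    simpa [a, b] using this
  refine ⟨homOfLeft (𝒰.glueMorphisms _ hglue), ?_, fun m hm => ?_⟩
  · apply hom_ext_left
    change Sigma.desc 𝒰.f ≫ 𝒰.glueMorphisms _ hglue = π
    refine Sigma.hom_ext _ _ fun i => ?_
    simp
  · apply hom_ext_left
    refine 𝒰.hom_ext _ _ fun i => ?_
    have : Sigma.desc 𝒰.f ≫ m.hom.left = π := congr(($hm).hom.left)
    rw [homOfLeft_left, Scheme.Cover.ι_glueMorphisms, ← this, Sigma.ι_desc_assoc]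

/-- A morphism from an affine scheme lifts to the disjoint union of the members of an open
cover of the target, after passing to a finite affine open cover of the source. -/
lemma exists_refinement {A : Sch} (u : A ⟶ X) :
    ∃ (𝒱 : Scheme.OpenCover.{0} A.obj.left) (_ : Finite 𝒱.I₀) (_ : ∀ i, IsAffine (𝒱.X i))
      (v : coverSch A 𝒱 ⟶ coverSch X 𝒰), coverMap A 𝒱 ≫ u = v ≫ coverMap X 𝒰 := by
  -- The preimages of the members of `𝒰` need not be affine, hence the affine refinement.
  let 𝒯 : Scheme.OpenCover.{0} A.obj.left := 𝒰.pullback₁ u.hom.left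
  let 𝒲 : Scheme.OpenCover.{0} A.obj.left := 𝒯.affineRefinement.openCover
  have h𝒲 (k : 𝒲.I₀) : IsAffine (𝒲.X k) :=
    inferInstanceAs (IsAffine (Spec (𝒯.affineRefinement.X k)))
  have h (k : 𝒲.I₀) : ∃ (j : 𝒰.I₀) (g : 𝒲.X k ⟶ 𝒰.X j), 𝒲.f k ≫ u.hom.left = g ≫ 𝒰.f j := by
    let j : 𝒰.I₀ := 𝒯.fromAffineRefinement.s₀ k
    let r : 𝒲.X k ⟶ 𝒯.X j := 𝒯.fromAffineRefinement.h₀ k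
    have hr : r ≫ 𝒯.f j = 𝒲.f k := 𝒯.fromAffineRefinement.w₀ k
    refine ⟨j, r ≫ 𝒰.pullbackHom u.hom.left j, ?_⟩
    rw [Category.assoc, Scheme.Cover.pullbackHom_map, ← hr]
    exact Category.assoc _ _ _
  let 𝒱 : Scheme.OpenCover.{0} A.obj.left := 𝒲.finiteSubcover
  replace h (i : 𝒱.I₀) : ∃ (j : 𝒰.I₀) (g : 𝒱.X i ⟶ 𝒰.X j),
      𝒱.f i ≫ u.hom.left = g ≫ 𝒰.f j := h _
  have hi (i : 𝒱.I₀) : IsAffine (𝒱.X i) := h𝒲 _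
  choose j g hg using h
  refine ⟨𝒱, inferInstanceAs (Finite 𝒲.finiteSubcover.I₀), hi, homOfLeft (Sigma.desc fun i => g i ≫ Sigma.ι 𝒰.X (j i)), ?_⟩
  apply hom_ext_left
  change Sigma.desc 𝒱.f ≫ u.hom.left =
    Sigma.desc (fun i => g i ≫ Sigma.ι 𝒰.X (j i)) ≫ Sigma.desc 𝒰.f
  refine Sigma.hom_ext _ _ fun i => ?_
  simp [hg]

end Covers

/-- A finite affine open cover of a scheme of finite type over `ℚ`. -/
def finiteAffineCover (X : Sch) : Scheme.OpenCover.{0} X.obj.left :=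
  X.obj.left.affineCover.finiteSubcover

instance (X : Sch) : Finite (finiteAffineCover X).I₀ :=
  inferInstanceAs (Finite X.obj.left.affineCover.finiteSubcover.I₀)

instance (X : Sch) (i) : IsAffine ((finiteAffineCover X).X i) :=
  have (j : X.obj.left.affineCover.I₀) : IsAffine (X.obj.left.affineCover.X j) := inferInstance
  this _

/-- `F` preserves the coequalizer given by the cover. This allows maps out of `F X` to be compared
on affine schemes. -/
lemma epi_map_coverMap (F : ExactEnd Sch) (X : Sch) (𝒰 : Scheme.OpenCover.{0} X.obj.left)
    [Finite 𝒰.I₀] [∀ i, IsAffine (𝒰.X i)] : Epi (F.obj.map (coverMap X 𝒰)) := by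
  have : PreservesFiniteColimits F.obj := F.property.2
  obtain ⟨V, -, a, b, w, ⟨h⟩⟩ := exists_isColimit_cofork X 𝒰
  exact ⟨fun _ _ e => Cofork.IsColimit.hom_ext (isColimitCoforkMapOfIsColimit F.obj w h) e⟩

/-! ### Extending a morphism of ring objects to a natural transformation. -/

variable {F G : ExactEnd Sch}

section

variable (φ : Ev.obj F ⟶ Ev.obj G)

lemma existsUnique_affineComponent (U : Sch) [IsAffine U.obj.left] :
    ∃! α : F.obj.obj U ⟶ G.obj.obj U, ∀ s : U ⟶ GaRing.X,
      α ≫ G.obj.map s = F.obj.map s ≫ φ.hom :=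
  (isAffineFor_gaRing U).existsUnique hasPolynomialEval_gaRing G
    ((postcompRingHom φ _).comp (mapRingHom GaRing F U))

/-- The component at an affine scheme of the natural transformation extending a morphism of
ring objects. -/
def affineComponent (U : Sch) [IsAffine U.obj.left] : F.obj.obj U ⟶ G.obj.obj U :=
  (existsUnique_affineComponent φ U).choose

lemma affineComponent_comp (U : Sch) [IsAffine U.obj.left] (s : U ⟶ GaRing.X) :
    affineComponent φ U ≫ G.obj.map s = F.obj.map s ≫ φ.hom :=
  (existsUnique_affineComponent φ U).choose_spec.1 s

/-- Both composites `F U ⟶ G V` correspond to the ring homomorphism `s ↦ F (f ≫ s) ≫ φ`. -/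
lemma affineComponent_naturality {U V : Sch} [IsAffine U.obj.left] [IsAffine V.obj.left]
    (f : U ⟶ V) :
    F.obj.map f ≫ affineComponent φ V = affineComponent φ U ≫ G.obj.map f := by
  refine ((isAffineFor_gaRing V).existsUnique hasPolynomialEval_gaRing G
    (((postcompRingHom φ _).comp (mapRingHom GaRing F U)).comp
      (precompRingHom GaRing f))).unique (fun s => ?_) (fun s => ?_)
  · rw [Category.assoc, affineComponent_comp]
    exact (congr($(F.obj.map_comp f s) ≫ φ.hom).trans (Category.assoc _ _ _)).symm
  · rw [Category.assoc, ← Functor.map_comp, affineComponent_comp]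
    rfl

/-- Descent along one cover yields `α`. Compatibility with all `u`, not only with that cover, is
what gives naturality in `X`. -/
lemma exists_component (X : Sch) :
    ∃ α : F.obj.obj X ⟶ G.obj.obj X, ∀ (A : Sch) [IsAffine A.obj.left] (u : A ⟶ X),
      F.obj.map u ≫ α = affineComponent φ A ≫ G.obj.map u := by
  have : PreservesFiniteColimits F.obj := F.property.2
  let 𝒰 := finiteAffineCover X
  obtain ⟨V, _, a, b, w, ⟨h⟩⟩ := exists_isColimit_cofork X 𝒰
  obtain ⟨α, hα⟩ := Cofork.IsColimit.desc' (isColimitCoforkMapOfIsColimit F.obj w h)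
    (affineComponent φ _ ≫ G.obj.map (coverMap X 𝒰)) (by
      rw [← Category.assoc, ← Category.assoc, affineComponent_naturality,
        affineComponent_naturality, Category.assoc, Category.assoc, ← Functor.map_comp,
        ← Functor.map_comp, w])
  refine ⟨α, fun A _ u => ?_⟩
  -- `u` itself need not lift to the cover of `X`; it does after an affine cover of `A`, whose image
  -- under `F` is epi.
  obtain ⟨𝒱, _, _, v, hv⟩ := exists_refinement X 𝒰 u
  have := epi_map_coverMap F A 𝒱
  rw [← cancel_epi (F.obj.map (coverMap A 𝒱)), ← Category.assoc, ← Functor.map_comp, hv,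
    Functor.map_comp, ← Category.assoc, affineComponent_naturality, Category.assoc,
    Category.assoc, ← Functor.map_comp, hv, Functor.map_comp,
    ← Category.assoc (affineComponent φ _), ← affineComponent_naturality, Category.assoc]
  exact congr(F.obj.map v ≫ $hα)

/-- The component of the natural transformation extending a morphism of ring objects. -/
def component (X : Sch) : F.obj.obj X ⟶ G.obj.obj X :=
  (exists_component φ X).choose

lemma map_comp_component {X A : Sch} [IsAffine A.obj.left] (u : A ⟶ X) :
    F.obj.map u ≫ component φ X = affineComponent φ A ≫ G.obj.map u :=
  (exists_component φ X).choose_spec A u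

/-- The natural transformation extending a morphism of ring objects. -/
def extension : F ⟶ G := ObjectProperty.homMk
  { app := component φ
    naturality X Y f := by
      have := epi_map_coverMap F X (finiteAffineCover X)
      rw [← cancel_epi (F.obj.map (coverMap X (finiteAffineCover X))), ← Category.assoc,
        ← Functor.map_comp, map_comp_component, ← Category.assoc, map_comp_component,
        Category.assoc, Functor.map_comp] }

instance isAffine_ga : IsAffine GaRing.X.obj.left :=
  inferInstanceAs (IsAffine 𝔸(PUnit.{1}; base))

/-- As `𝔾ₐ` is affine, both defining properties apply to its identity. -/
lemma ev_map_extension : Ev.map (extension φ) = φ := by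
  ext1
  have h₁ := map_comp_component φ (𝟙 GaRing.X)
  have h₂ := affineComponent_comp φ GaRing.X (𝟙 GaRing.X)
  rw [F.obj.map_id] at h₁ h₂
  exact ((Category.id_comp _).symm.trans (h₁.trans h₂)).trans (Category.id_comp _)

end

/-- By naturality both satisfy the condition that determines affine components; affine covers give
the rest. -/
lemma hom_ext_of_ev_map_eq {α β : F ⟶ G} (h : Ev.map α = Ev.map β) : α = β := by
  have key (U : Sch) [IsAffine U.obj.left] : α.hom.app U = β.hom.app U := by
    refine (existsUnique_affineComponent (Ev.map α) U).unique
      (fun s => (α.hom.naturality s).symm) (fun s => ?_)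
    rw [h]
    exact (β.hom.naturality s).symm
  ext X : 3
  have := epi_map_coverMap F X (finiteAffineCover X)
  rw [← cancel_epi (F.obj.map (coverMap X (finiteAffineCover X))), α.hom.naturality,
    β.hom.naturality, key]

end SchQ

end

theorem mainTheorem4 : SchQ.Ev.Full ∧ SchQ.Ev.Faithful :=
  ⟨⟨fun φ => ⟨SchQ.extension φ, SchQ.ev_map_extension φ⟩⟩, ⟨SchQ.hom_ext_of_ev_map_eq⟩⟩
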